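/- **QNPs.** A QNP $Q$ consists of a finite set $At$ of boolean atoms, a finite set $V$ of numerical variables, a set of actions, an initial situation $I$ and a goal $G$. Literals are $p$, $\neg p$ for $p\in At$ and $x=0$, $x>0$ for $x\in V$; $I$ is a maximal consistent set of literals, $G$ a set of literals. An action has a set of precondition literals, a consistent set of boolean effect literals, and effects $Inc(x)$ and $Dec(x)$ for $x$ in two disjoint sets of variables; an action with effect $Dec(x)$ has the precondition $x>0$. **FOND problems.** A FOND problem $P$ has boolean states, an initial state $s_0$, a goal (a set of literals) and actions with precondition literals, deterministic effects and effects $\mathrm{oneof}(E_1,\dots,E_n)$, from each of which one alternative is chosen independently. $F(a,s)$ is the set of successors of $s$ under $a$, and $a$ is applicable in $s$ iff $F(a,s)\neq\emptyset$. The direct translation $T_D(Q)$ is the FOND problem over the atoms $At\cup\{p_x : x\in V\}$ obtained by replacing $x=0$ by $p_x$, $x>0$ by $\neg p_x$, $Inc(x)$ by the effect $\neg p_x$ ("increments $x$") and $Dec(x)$ by the effect $\mathrm{oneof}(p_x,\neg p_x)$ ("decrements $x$"). **Policies and trajectories.** A policy $\pi$ is a partial function from non-goal states to actions. A $\pi$-trajectory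 is a finite or infinite sequence $s_0,s_1,\dots$ starting in the initial state with $s_{i+1}\in F(\pi(s_i),s_i)$. It is maximal if it is infinite, or if its last state is a goal state, or is one where $\pi$ is undefined or prescribes an inapplicable action. $\pi$ reaches $s'$ from $s$ if there is a path (possibly of length $0$) of such transitions from $s$ to $s'$; $\pi$ is strong-cyclic if a goal state is reached from every state that is reached from the initial state. **Solutions of a QNP.** A numerical state assigns truth values to $At$ and non-negative reals to $V$; its qualitative state is the state of $T_D(Q)$ in which $p_x$ is true iff $x=0$. Let $\pi$ be a policy for $T_D(Q)$. For $\varepsilon>0$, an $\varepsilon$-bounded $\pi$-trajectory of $Q$ is a sequence of numerical states that starts in some numerical state satisfying $I$ and in which each step applies the (applicable) action that $\pi$ prescribes for the current qualitative state: the boolean effects take place, $Inc(x)$ increases $x$ by some positive amount, $Dec(x)$ strictly decreases $x$, either to $0$ or by at least $\varepsilon$, and nothing else changes. Maximality is defined as above. $\pi$ *solves* $Q$ if for every $\varepsilon>0$ all maximal $\varepsilon$-bounded $\pi$-trajectories of $Q$ reach the goal. **Termination.** A cycle on a state is a path of length at least $1$, along transitions of $\pi$, from the state to itself. The set of *terminating*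 states of $T_D(Q)$ is defined inductively (as the least such set): $s$ terminates iff (1) there is no cycle on $s$, or (2) every cycle on $s$ contains a state that terminates, or (3) $\pi(s)$ decrements a variable $x$, and every cycle on $s$ containing a state $s'$ for which $\pi(s')$ increments $x$ also contains a state that terminates. $\pi$ *terminates* if every state reached by $\pi$ terminates. **FOND$^+$ problems.** A FOND$^+$ problem $\langle P,C\rangle$ is a FOND problem $P$ with a set $C$ of fairness assumptions $A/B$, where $A$ is a set of non-deterministic actions of $P$ and $B$ a set of actions of $P$ disjoint from $A$. The occurrence of $\pi(s)$ in a recurrent (infinitely often occurring) state $s$ of a $\pi$-trajectory $\tau$ is fair if, for some $A/B\in C$, $\pi(s)\in A$ and every action of $B$ occurs only finitely often in $\tau$. The trajectory $\tau$ is fair if every recurrent state $s$ of $\tau$ in which the occurrence of $\pi(s)$ is fair is immediately followed infinitely often in $\tau$ by each $s'\in F(\pi(s),s)$. $\pi$ *solves* $\langle P,C\rangle$ if all maximal fair $\pi$-trajectories reach a goal state. **Theorem.** Let $Q$ be a QNP and let $C=\{A_x/B_x : x\in V\}$, where $A_x$ is the set of all actions of $T_D(Q)$ that decrement $x$ and $B_x$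 the set of all actions of $T_D(Q)$ that increment $x$. Then for every policy $\pi$, $$\pi \text{ solves } Q \iff \pi \text{ solves } \langle T_D(Q),C\rangle .$$ Moreover, equivalently, $\pi$ is a strong-cyclic solution of $T_D(Q)$ that terminates $\iff$ $\pi$ solves $\langle T_D(Q),C\rangle$. -/

import Mathlib

namespace Planning

open scoped NNReal

/-! ### FOND problems -/

/-- Boolean literals over a set `α` of atoms. -/
inductive Literal (α : Type*) where
  | pos (p : α) : Literal α
  | neg (p : α) : Literal α

/-- A state (truth valuation) is represented by the set of atoms that are true in it. -/
def Literal.Holds {α : Type*} (s : Set α) : Literal α → Prop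
  | .pos p => p ∈ s
  | .neg p => p ∉ s

/-- A set of literals containing no complementary pair. -/
def Consistent {α : Type*} (E : Set (Literal α)) : Prop :=
  ∀ p, ¬ (Literal.pos p ∈ E ∧ Literal.neg p ∈ E)

/-- An action of a FOND problem: preconditions, deterministic effects, and a collection of
non-deterministic effects `oneof(E₁, …, Eₙ)`, each of them given as the set `{E₁, …, Eₙ}`. -/
structure FONDAction (α : Type*) where
  pre : Set (Literal α)
  eff : Set (Literal α)
  oneof : Set (Set (Set (Literal α)))

/-- A non-deterministic action is one with an effect `oneof(E₁, …, Eₙ)` that has at least two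
different alternatives. -/
def FONDAction.Nondeterministic {α : Type*} (a : FONDAction α) : Prop :=
  ∃ o ∈ a.oneof, o.Nontrivial

/-- The possible total effects of an action: the deterministic effects together with one alternative
chosen (independently) from every `oneof`. -/
def FONDAction.outcomes {α : Type*} (a : FONDAction α) : Set (Set (Literal α)) :=
  {E | ∃ c : Set (Set (Literal α)) → Set (Literal α),
    (∀ o ∈ a.oneof, c o ∈ o) ∧ E = a.eff ∪ ⋃ o ∈ a.oneof, c o}

/-- `s'` is the result of applying the effects `E` in `s`: the literals of `E` become true, and the
atoms not mentioned in `E` keep their value. -/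
def IsResult {α : Type*} (s : Set α) (E : Set (Literal α)) (s' : Set α) : Prop :=
  (∀ l ∈ E, l.Holds s') ∧
    ∀ p, Literal.pos p ∉ E → Literal.neg p ∉ E → (p ∈ s' ↔ p ∈ s)

/-- A FOND problem over the atoms `α` with action names `Act`. -/
structure FOND (α Act : Type*) where
  /-- the atoms that are true initially; as a state, this is the initial state `s₀` -/
  init : Set α
  action : Act → FONDAction α
  goal : Set (Literal α)

namespace FOND

variable {α Act : Type*}

def IsGoal (P : FOND α Act) (s : Set α) : Prop := ∀ l ∈ P.goal, l.Holds s

/-- `F(a,s)`: the possible successors of `s` under the action `a`. -/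
def F (P : FOND α Act) (a : Act) (s : Set α) : Set (Set α) :=
  {s' | (∀ l ∈ (P.action a).pre, l.Holds s) ∧ ∃ E ∈ (P.action a).outcomes, IsResult s E s'}

/-- `a ∈ A(s)`. -/
def Applicable (P : FOND α Act) (a : Act) (s : Set α) : Prop := (P.F a s).Nonempty

end FOND

/-- A policy: a partial function mapping non-goal states into actions. -/
structure Policy {α Act : Type*} (P : FOND α Act) where
  act : Set α → Option Act
  act_goal : ∀ s, P.IsGoal s → act s = none

/-- A finite or infinite sequence of states. `len` is the number of its transitions, `⊤` if it is
infinite; the sequence consists of the values `state i` with `i ≤ len`. -/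
structure Trajectory (S : Type*) where
  len : ℕ∞
  state : ℕ → S

namespace FOND

variable {α Act : Type*} (P : FOND α Act) (π : Policy P)

/-- Possible transitions under the policy. -/
def Edge (s s' : Set α) : Prop := ∃ a, π.act s = some a ∧ s' ∈ P.F a s

/-- `π`-trajectories. -/
def IsTrajectory (τ : Trajectory (Set α)) : Prop :=
  τ.state 0 = P.init ∧
    ∀ i : ℕ, ((i + 1 : ℕ) : ℕ∞) ≤ τ.len → P.Edge π (τ.state i) (τ.state (i + 1))

/-- Maximality of a `π`-trajectory: it is infinite, or it ends in a goal state, or no action is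
prescribed in its last state, or the prescribed action is not applicable there. -/
def IsMaximal (τ : Trajectory (Set α)) : Prop :=
  ∀ n : ℕ, τ.len = n →
    P.IsGoal (τ.state n) ∨ π.act (τ.state n) = none ∨
      ∃ a, π.act (τ.state n) = some a ∧ ¬ P.Applicable a (τ.state n)

def ReachesGoal (τ : Trajectory (Set α)) : Prop :=
  ∃ i : ℕ, (i : ℕ∞) ≤ τ.len ∧ P.IsGoal (τ.state i)

/-- `s` is reached by the policy. -/
def Reachable (s : Set α) : Prop := Relation.ReflTransGen (P.Edge π) P.init s

/-- Strong-cyclic solutions: a goal state is reached from every state reached by the policy. -/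
def StrongCyclic : Prop :=
  ∀ s, P.Reachable π s → ∃ g, P.IsGoal g ∧ Relation.ReflTransGen (P.Edge π) s g

/-- `w 0, …, w n` is a cycle on `s`: a path with at least one edge from `s` to itself. -/
def IsCycleOn (s : Set α) (n : ℕ) (w : ℕ → Set α) : Prop :=
  0 < n ∧ w 0 = s ∧ w n = s ∧ ∀ i < n, P.Edge π (w i) (w (i + 1))

end FOND

/-! ### FOND⁺ problems -/

/-- A conditional fairness assumption `A/B`. -/
structure FairnessAssumption {α Act : Type*} (P : FOND α Act) where
  A : Set Act
  B : Set Act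
  nondet : ∀ a ∈ A, (P.action a).Nondeterministic
  disj : Disjoint A B

/-- A FOND⁺ problem `⟨P, C⟩`. -/
structure FONDPlus (α Act : Type*) where
  problem : FOND α Act
  C : Set (FairnessAssumption problem)

/-- `s` occurs infinitely often in `τ`. -/
def Trajectory.Recurrent {S : Type*} (τ : Trajectory S) (s : S) : Prop :=
  ∀ n : ℕ, ∃ i : ℕ, n ≤ i ∧ (i : ℕ∞) ≤ τ.len ∧ τ.state i = s

/-- `s` is immediately followed by `s'` infinitely often in `τ`. -/
def Trajectory.FollowedInfinitelyOften {S : Type*} (τ : Trajectory S) (s s' : S) : Prop :=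
  ∀ n : ℕ, ∃ i : ℕ, n ≤ i ∧ ((i + 1 : ℕ) : ℕ∞) ≤ τ.len ∧ τ.state i = s ∧ τ.state (i + 1) = s'

namespace FONDPlus

variable {α Act : Type*} (Pc : FONDPlus α Act) (π : Policy Pc.problem)

/-- The action `b` occurs infinitely often in the `π`-trajectory `τ`. -/
def OccursInfinitelyOften (τ : Trajectory (Set α)) (b : Act) : Prop :=
  ∀ n : ℕ, ∃ i : ℕ, n ≤ i ∧ ((i + 1 : ℕ) : ℕ∞) ≤ τ.len ∧ π.act (τ.state i) = some b

/-- The occurrence of `π(s)` in the (recurrent) state `s` of `τ` is fair. -/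
def FairOccurrence (τ : Trajectory (Set α)) (s : Set α) : Prop :=
  ∃ c ∈ Pc.C, (∃ a ∈ c.A, π.act s = some a) ∧
    ∀ b ∈ c.B, ¬ Pc.OccursInfinitelyOften π τ b

/-- Fair `π`-trajectories. -/
def Fair (τ : Trajectory (Set α)) : Prop :=
  ∀ s, τ.Recurrent s → Pc.FairOccurrence π τ s →
    ∀ s', Pc.problem.Edge π s s' → τ.FollowedInfinitelyOften s s'

/-- `π` solves the FOND⁺ problem: all its maximal fair trajectories reach the goal. -/
def Solves : Prop :=
  ∀ τ : Trajectory (Set α), Pc.problem.IsTrajectory π τ → Pc.problem.IsMaximal π τ →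
    Pc.Fair π τ → Pc.problem.ReachesGoal τ

end FONDPlus

/-! ### Qualitative numerical planning problems -/

/-- Literals of a QNP: boolean literals, and `x = 0`, `x > 0` for the numerical variables `x`. -/
inductive QLiteral (At V : Type*) where
  | bool (l : Literal At) : QLiteral At V
  | eqZero (x : V) : QLiteral At V
  | gtZero (x : V) : QLiteral At V

/-- An action of a QNP. `inc` (`dec`) is the set of variables `x` with effect `Inc(x)` (`Dec(x)`). -/
structure QAction (At V : Type*) where
  pre : Set (QLiteral At V)
  eff : Set (Literal At)
  inc : Set V
  dec : Set V
  eff_consistent : Consistent eff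
  inc_dec_disjoint : Disjoint inc dec
  dec_pre : ∀ x ∈ dec, QLiteral.gtZero x ∈ pre

/-- A QNP with boolean atoms `At`, numerical variables `V` and action names `Act`. The initial
situation is a maximal consistent set of literals. -/
structure QNP (At V Act : Type*) where
  init : Set (QLiteral At V)
  init_bool : ∀ p : At,
    Xor (QLiteral.bool (.pos p) ∈ init) (QLiteral.bool (.neg p) ∈ init)
  init_num : ∀ x : V, Xor (QLiteral.eqZero x ∈ init) (QLiteral.gtZero x ∈ init)
  action : Act → QAction At V
  goal : Set (QLiteral At V)

/-- A numerical state: the set of true atoms, and the values of the numerical variables. -/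
structure NumState (At V : Type*) where
  atoms : Set At
  val : V → ℝ≥0

def QLiteral.Holds {At V : Type*} (s : NumState At V) : QLiteral At V → Prop
  | .bool l => l.Holds s.atoms
  | .eqZero x => s.val x = 0
  | .gtZero x => 0 < s.val x

/-- The boolean literal that replaces a literal of the QNP: the atom `p_x = Sum.inr x` stands for
the expression `x = 0`. -/
def QLiteral.translate {At V : Type*} : QLiteral At V → Literal (At ⊕ V)
  | .bool (.pos p) => .pos (.inl p)
  | .bool (.neg p) => .neg (.inl p)
  | .eqZero x => .pos (.inr x)
  | .gtZero x => .neg (.inr x)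

/-- The direct translation of an action: `Inc(x)` becomes `¬p_x`, and `Dec(x)` becomes
`oneof(p_x, ¬p_x)`. -/
def QAction.translate {At V : Type*} (a : QAction At V) : FONDAction (At ⊕ V) where
  pre := QLiteral.translate '' a.pre
  eff := ((fun l => (QLiteral.bool l : QLiteral At V).translate) '' a.eff) ∪
    ((fun x => Literal.neg (Sum.inr x)) '' a.inc)
  oneof := (fun x => {{Literal.pos (Sum.inr x)}, {Literal.neg (Sum.inr x)}}) '' a.dec

namespace FOND

variable {At V Act : Type*} (P : FOND (At ⊕ V) Act)

/-- `a` increments `x`: it has the effect `¬p_x`. -/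
def Increments (a : Act) (x : V) : Prop :=
  Literal.neg (Sum.inr x) ∈ (P.action a).eff

/-- `a` decrements `x`: it has the effect `oneof(p_x, ¬p_x)`. -/
def Decrements (a : Act) (x : V) : Prop :=
  ({{Literal.pos (Sum.inr x)}, {Literal.neg (Sum.inr x)}} : Set (Set (Literal (At ⊕ V)))) ∈
    (P.action a).oneof

variable (π : Policy P)

/-- The three rules for labelling a state `s` as terminating when the states in `X` already are:
there is no cycle on `s`; every cycle on `s` contains a terminating state; or `π(s)` decrements a
variable `x` and every cycle on `s` containing a state where `x` is incremented also contains a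
terminating state. -/
def TerminationRule (X : Set (Set (At ⊕ V))) (s : Set (At ⊕ V)) : Prop :=
  (∀ n w, ¬ P.IsCycleOn π s n w) ∨
  (∀ n w, P.IsCycleOn π s n w → ∃ i ≤ n, w i ∈ X) ∨
  (∃ a x, π.act s = some a ∧ P.Decrements a x ∧
    ∀ n w, P.IsCycleOn π s n w →
      (∃ i ≤ n, ∃ b, π.act (w i) = some b ∧ P.Increments b x) → ∃ i ≤ n, w i ∈ X)

/-- Terminating states, by induction on the rules: the least set of states closed under them. -/
def TerminatingState (s : Set (At ⊕ V)) : Prop :=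
  ∀ X : Set (Set (At ⊕ V)), (∀ t, P.TerminationRule π X t → t ∈ X) → s ∈ X

/-- The policy terminates: every state that it reaches is terminating. -/
def Terminates : Prop := ∀ s, P.Reachable π s → P.TerminatingState π s

end FOND

namespace QNP

variable {At V Act : Type*} (Q : QNP At V Act)

/-- The direct translation `T_D(Q)`. -/
def directTranslation : FOND (At ⊕ V) Act where
  init := {p | Literal.pos p ∈ QLiteral.translate '' Q.init}
  action a := (Q.action a).translate
  goal := QLiteral.translate '' Q.goal

theorem increments_iff (a : Act) (x : V) :
    Q.directTranslation.Increments a x ↔ x ∈ (Q.action a).inc := by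
  constructor
  · rintro (⟨l, -, hl⟩ | ⟨y, hy, hl⟩)
    · cases l <;> simp [QLiteral.translate] at hl
    · simp only [Literal.neg.injEq, Sum.inr.injEq] at hl
      exact hl ▸ hy
  · exact fun h => Or.inr ⟨x, h, rfl⟩

theorem decrements_iff (a : Act) (x : V) :
    Q.directTranslation.Decrements a x ↔ x ∈ (Q.action a).dec := by
  constructor
  · rintro ⟨y, hy, hxy⟩
    have h : ({Literal.pos (Sum.inr y)} : Set (Literal (At ⊕ V))) ∈
        ({{Literal.pos (Sum.inr x)}, {Literal.neg (Sum.inr x)}} : Set (Set (Literal (At ⊕ V)))) :=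
      hxy ▸ Or.inl rfl
    simp only [Set.mem_insert_iff, Set.mem_singleton_iff, Set.singleton_eq_singleton_iff,
      Literal.pos.injEq, Sum.inr.injEq, reduceCtorEq, or_false] at h
    exact h ▸ hy
  · exact fun h => ⟨x, h, rfl⟩

/-- The fairness assumption `A_x/B_x` of the numerical variable `x`: `A_x` (`B_x`) is the set of all
the actions of `T_D(Q)` that decrement (increment) `x`. -/
def assumption (x : V) : FairnessAssumption Q.directTranslation where
  A := {a | Q.directTranslation.Decrements a x}
  B := {a | Q.directTranslation.Increments a x}
  nondet a ha := by
    refine ⟨_, ha, _, Or.inl rfl, _, Or.inr rfl, ?_⟩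
    simp
  disj := by
    rw [Set.disjoint_left]
    intro a ha hb
    exact Set.disjoint_left.1 (Q.action a).inc_dec_disjoint
      ((Q.increments_iff a x).1 hb) ((Q.decrements_iff a x).1 ha)

/-- The FOND⁺ problem `⟨T_D(Q), {A_x/B_x : x ∈ V}⟩`. -/
def toFONDPlus : FONDPlus (At ⊕ V) Act where
  problem := Q.directTranslation
  C := Set.range Q.assumption

/-- The qualitative state of a numerical state: the truth values of the atoms `p ∈ At` and of the
expressions `x = 0`. It is a state of `T_D(Q)`. -/
def qualState (s : NumState At V) : Set (At ⊕ V) :=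
  {q | match q with
    | .inl p => p ∈ s.atoms
    | .inr x => s.val x = 0}

def IsGoal (s : NumState At V) : Prop := ∀ l ∈ Q.goal, l.Holds s

def Applicable (a : Act) (s : NumState At V) : Prop := ∀ l ∈ (Q.action a).pre, l.Holds s

/-- The transitions of the QNP: increments and decrements are by arbitrary positive amounts, no
variable becomes negative, and a decrement is by at least `ε` unless it makes the variable zero. -/
def Step (ε : ℝ≥0) (a : Act) (s s' : NumState At V) : Prop :=
  Q.Applicable a s ∧ IsResult s.atoms (Q.action a).eff s'.atoms ∧
    (∀ x ∈ (Q.action a).inc, s.val x < s'.val x) ∧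
    (∀ x ∈ (Q.action a).dec, s'.val x < s.val x ∧ (s'.val x = 0 ∨ s'.val x + ε ≤ s.val x)) ∧
    (∀ x, x ∉ (Q.action a).inc → x ∉ (Q.action a).dec → s'.val x = s.val x)

variable (π : Policy Q.directTranslation)

/-- The `ε`-bounded trajectories of the QNP that are compatible with the policy `π`, which observes
only qualitative states. The initial values of the variables are arbitrary, subject to the initial
situation. -/
def IsTrajectory (ε : ℝ≥0) (τ : Trajectory (NumState At V)) : Prop :=
  (∀ l ∈ Q.init, l.Holds (τ.state 0)) ∧
    ∀ i : ℕ, ((i + 1 : ℕ) : ℕ∞) ≤ τ.len →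
      ∃ a, π.act (qualState (τ.state i)) = some a ∧ Q.Step ε a (τ.state i) (τ.state (i + 1))

def IsMaximal (τ : Trajectory (NumState At V)) : Prop :=
  ∀ n : ℕ, τ.len = n →
    Q.IsGoal (τ.state n) ∨ π.act (qualState (τ.state n)) = none ∨
      ∃ a, π.act (qualState (τ.state n)) = some a ∧ ¬ Q.Applicable a (τ.state n)

def ReachesGoal (τ : Trajectory (NumState At V)) : Prop :=
  ∃ i : ℕ, (i : ℕ∞) ≤ τ.len ∧ Q.IsGoal (τ.state i)

/-- `π` solves the QNP: for every `ε > 0`, all maximal `ε`-bounded trajectories compatible with `π`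
reach the goal. -/
def Solves : Prop :=
  ∀ ε : ℝ≥0, 0 < ε → ∀ τ : Trajectory (NumState At V),
    Q.IsTrajectory π ε τ → Q.IsMaximal π τ → Q.ReachesGoal τ

end QNP

end Planning

/-!
The three properties of `π` are shown to imply one another in a circle.

*A policy that solves the FOND⁺ problem is strong-cyclic and terminates.* In a countable graph
without dead ends there is an infinite walk that leaves each vertex `s` by its successors in a
round-robin fashion, so that every edge out of a recurrent vertex is used infinitely often
(`exists_fair_walk`). If no goal is reached from some reachable `s`, such a walk from `s` is a
maximal fair trajectory that misses the goal, unless a dead end is reached from `s`, which is a finite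
maximal trajectory of this kind. If a reachable `s` is not terminating, take the walk in the graph of
the non-terminating states. Its set of recurrent states is closed under edges, so whenever a
recurrent state decrements `x`, the failure of the third rule provides a recurrent state that
increments `x`. Hence no occurrence of an action is fair, and the trajectory is vacuously fair.

*A terminating strong-cyclic policy solves the QNP.* The qualitative states of a numerical trajectory
form a trajectory of the translation. If it is infinite, the set of states that do not recur in it is
closed under the three rules: if `π(s)` decrements `x` in a recurrent `s` and `x` is incremented only
finitely often, then `x` would decrease by at least `ε` infinitely often. So no terminating state
recurs, although some state must.

*A policy that solves the QNP solves the FOND⁺ problem.* In a fair trajectory that misses the goal,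
every variable that is decremented infinitely often is incremented infinitely often, since otherwise
fairness would make it zero for good. Then the trajectory is the qualitative shadow of a `1`-bounded
numerical one (`exists_numTrajectory`): every increment is chosen large enough to pay for all
decrements before the next increment.
-/

namespace Planning

open Filter Relation

/-! ### Walks in directed graphs -/

section Walks

variable {S : Type*}

theorem eventually_frequently_eq [Finite S] (f : ℕ → S) :
    ∀ᶠ i in atTop, ∃ᶠ j in atTop, f j = f i := by
  have h : ∀ᶠ i in atTop, ∀ s : S, (¬ ∃ᶠ j in atTop, f j = s) → f i ≠ s := by
    rw [eventually_all]
    intro s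
    by_cases hs : ∃ᶠ j in atTop, f j = s
    · exact Eventually.of_forall fun i h => absurd hs h
    · exact (not_frequently.1 hs).mono fun i hi _ => hi
  filter_upwards [h] with i hi
  by_contra hc
  exact hi _ hc rfl

theorem exists_path_of_reflTransGen {R : S → S → Prop} {a b : S} (h : ReflTransGen R a b) :
    ∃ (n : ℕ) (w : ℕ → S), w 0 = a ∧ w n = b ∧ ∀ i < n, R (w i) (w (i + 1)) := by
  induction h with
  | refl => exact ⟨0, fun _ => a, rfl, rfl, by simp⟩
  | @tail b c _ hbc ih =>
    obtain ⟨n, w, h0, hn, hw⟩ := ih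
    refine ⟨n + 1, fun i => if i ≤ n then w i else c, by simpa using h0, by simp, ?_⟩
    intro i hi
    rcases Nat.lt_succ_iff_lt_or_eq.1 hi with hi | rfl
    · simpa [hi.le, Nat.succ_le_of_lt hi] using hw i hi
    · simpa [hn] using hbc

theorem reflTransGen_of_walk {R : S → S → Prop} {w : ℕ → S} {m n : ℕ} (hmn : m ≤ n)
    (hw : ∀ i, m ≤ i → i < n → R (w i) (w (i + 1))) : ReflTransGen R (w m) (w n) := by
  induction n, hmn using Nat.le_induction with
  | base => exact .refl
  | succ n hmn ih => exact (ih fun i h1 h2 => hw i h1 (by omega)).tail (hw n hmn (by omega))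

/-- An infinite walk can be preceded by any path that leads to its first vertex. -/
theorem exists_walk_of_reflTransGen {R : S → S → Prop} {a : S} {f : ℕ → S}
    (h : ReflTransGen R a (f 0)) (hf : ∀ i, R (f i) (f (i + 1))) :
    ∃ (g : ℕ → S) (N : ℕ), g 0 = a ∧ (∀ i, R (g i) (g (i + 1))) ∧ ∀ i, g (i + N) = f i := by
  obtain ⟨n, w, h0, hn, hw⟩ := exists_path_of_reflTransGen h
  refine ⟨fun i => if i ≤ n then w i else f (i - n), n, by simpa using h0, fun i => ?_, fun i => ?_⟩
  · rcases lt_trichotomy i n with hi | rfl | hi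
    · simpa [hi.le, Nat.succ_le_of_lt hi] using hw i hi
    · simpa [hn] using hf 0
    · simpa [not_le.2 hi, show ¬ i + 1 ≤ n by omega, show i + 1 - n = i - n + 1 by omega]
        using hf (i - n)
  · rcases Nat.eq_zero_or_pos i with rfl | hi
    · simpa using hn
    · simp [show ¬ i + n ≤ n by omega]

/-- If no dead end is reached from `s₀`, there is an infinite walk from `s₀` that uses every edge out
of each of its recurrent vertices infinitely often: on the `k`-th visit to `s` it moves to the `k`-th
term of a fixed sequence of successors of `s` in which every successor occurs infinitely often. -/
theorem exists_fair_walk [Countable S] {R : S → S → Prop} {s₀ : S}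
    (h : ∀ s, ReflTransGen R s₀ s → ∃ t, R s t) :
    ∃ f : ℕ → S, f 0 = s₀ ∧ (∀ i, R (f i) (f (i + 1))) ∧
      ∀ s t, R s t → (∃ᶠ i in atTop, f i = s) → ∃ᶠ i in atTop, f i = s ∧ f (i + 1) = t := by
  classical
  have he : ∀ s, ∃ e : ℕ → S, (∃ t, R s t) →
      (∀ n, R s (e n)) ∧ ∀ t, R s t → ∃ᶠ n in atTop, e n = t := by
    intro s
    by_cases hs : ∃ t, R s t
    · obtain ⟨t₀, ht₀⟩ := hs
      have : Nonempty {t // R s t} := ⟨⟨t₀, ht₀⟩⟩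
      obtain ⟨g, hg⟩ := exists_surjective_nat {t // R s t}
      refine ⟨fun n => g n.unpair.1, fun _ => ⟨fun n => (g _).2, fun t ht => ?_⟩⟩
      obtain ⟨k, hk⟩ := hg ⟨t, ht⟩
      rw [frequently_atTop]
      exact fun N => ⟨Nat.pair k N, Nat.right_le_pair k N, by simp [hk]⟩
    · exact ⟨fun _ => s, fun h => absurd h hs⟩
  choose e he using he
  -- The second component counts the visits to each vertex.
  let g : ℕ → S × (S → ℕ) := fun n => Nat.rec (s₀, fun _ => 0)
    (fun _ q => (e q.1 (q.2 q.1), Function.update q.2 q.1 (q.2 q.1 + 1))) n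
  have hg1 : ∀ n, (g (n + 1)).1 = e (g n).1 ((g n).2 (g n).1) := fun n => rfl
  have hg2 : ∀ n, (g (n + 1)).2 = Function.update (g n).2 (g n).1 ((g n).2 (g n).1 + 1) :=
    fun n => rfl
  have hcount : ∀ s n, (g n).2 s = Nat.count (fun i => (g i).1 = s) n := by
    intro s n
    induction n with
    | zero => simp [g]
    | succ n ih =>
      rw [hg2, Nat.count_succ, ← ih]
      by_cases hs : (g n).1 = s
      · subst hs; simp
      · simp [hs, Function.update_of_ne (Ne.symm hs)]
  have hreach : ∀ n, ReflTransGen R s₀ (g n).1 := by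
    intro n
    induction n with
    | zero => exact .refl
    | succ n ih => exact ih.tail ((he _ (h _ ih)).1 _)
  refine ⟨fun n => (g n).1, rfl, fun n => (he _ (h _ (hreach n))).1 _, fun s t hst hs => ?_⟩
  rw [frequently_atTop]
  intro N
  obtain ⟨k, hk, hkt⟩ := frequently_atTop.1 ((he s ⟨t, hst⟩).2 t hst) N
  have hinf : {i | (g i).1 = s}.Infinite := Nat.frequently_atTop_iff_infinite.1 hs
  have hmem : (g (Nat.nth (fun i => (g i).1 = s) k)).1 = s := Nat.nth_mem_of_infinite hinf k
  have hc := Nat.count_nth_of_infinite hinf k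
  refine ⟨Nat.nth (fun i => (g i).1 = s) k, ?_, hmem, ?_⟩
  · calc N ≤ k := hk
      _ = _ := hc.symm
      _ ≤ _ := Nat.count_le _
  · show (g (_ + 1)).1 = t
    rw [hg1, hmem, hcount, hc, hkt]

/-- If an event `inc` occurs infinitely often or an event `dec` only finitely often, there is a
budget `D` that pays for every occurrence of `dec` and needs to be raised only at occurrences of
`inc`. -/
theorem exists_rank {inc dec : ℕ → Prop} (hdisj : ∀ i, inc i → ¬ dec i)
    (h : (∃ᶠ i in atTop, inc i) ∨ ∀ᶠ i in atTop, ¬ dec i) :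
    ∃ D : ℕ → ℕ, ∀ i, (dec i → D (i + 1) < D i) ∧ (¬ inc i → D (i + 1) ≤ D i) := by
  classical
  rcases h with h | h
  · rw [frequently_atTop] at h
    -- The time until the next occurrence of `inc`.
    refine ⟨fun i => Nat.find (h i) - i, fun i => ?_⟩
    have key : ¬ inc i → Nat.find (h (i + 1)) - (i + 1) < Nat.find (h i) - i := by
      intro hi
      obtain ⟨h1, h2⟩ := Nat.find_spec (h i)
      have h3 : Nat.find (h i) ≠ i := fun he => hi (he ▸ h2)
      have h4 : Nat.find (h (i + 1)) ≤ Nat.find (h i) := Nat.find_min' _ ⟨by omega, h2⟩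
      omega
    exact ⟨fun hd => key fun hi => hdisj i hi hd, fun hi => (key hi).le⟩
  · obtain ⟨N, hN⟩ := eventually_atTop.1 h
    refine ⟨fun i => N - i, fun i => ⟨fun hd => ?_, fun _ => by dsimp only; omega⟩⟩
    have : i < N := not_le.1 fun hi => hN i hi hd
    dsimp only
    omega

end Walks

/-! ### Infinite trajectories -/

theorem Trajectory.recurrent_iff_frequently {S : Type*} {τ : Trajectory S} (h : τ.len = ⊤) {s : S} :
    τ.Recurrent s ↔ ∃ᶠ i in atTop, τ.state i = s := by
  simp [Trajectory.Recurrent, frequently_atTop, h]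

theorem Trajectory.not_recurrent_of_len_eq {S : Type*} {τ : Trajectory S} {n : ℕ} (h : τ.len = n)
    (s : S) : ¬ τ.Recurrent s := by
  intro hs
  obtain ⟨i, hi, hi', -⟩ := hs (n + 1)
  rw [h] at hi'
  have := Nat.cast_le.1 hi'
  omega

/-! ### Trajectories of FOND problems that miss the goal -/

namespace FOND

variable {α Act : Type*} {P : FOND α Act} {π : Policy P}

theorem not_isGoal_of_edge {s t : Set α} (h : P.Edge π s t) : ¬ P.IsGoal s := by
  obtain ⟨a, ha, -⟩ := h
  intro hg
  simp [π.act_goal s hg] at ha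

/-- A segment of an infinite walk that returns to its first state is a cycle. -/
theorem isCycleOn_segment {f : ℕ → Set α} {m n : ℕ}
    (hf : ∀ i, P.Edge π (f i) (f (i + 1))) (hmn : m < n) (h : f n = f m) :
    P.IsCycleOn π (f m) (n - m) fun i => f (m + i) :=
  ⟨by omega, rfl, by simpa [show m + (n - m) = n by omega] using h, fun i _ => hf (m + i)⟩

end FOND

namespace FONDPlus

variable {α Act : Type*} {Pc : FONDPlus α Act} {π : Policy Pc.problem}

/-- In a FOND⁺ problem that is solved by `π`, no dead end without goal is reached. -/
theorem Solves.exists_edge (hsol : Pc.Solves π) {s : Set α} (hs : Pc.problem.Reachable π s)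
    (hg : ¬ Pc.problem.IsGoal s) : ∃ t, Pc.problem.Edge π s t := by
  by_contra hdead
  obtain ⟨n, w, h0, hn, hw⟩ := exists_path_of_reflTransGen hs
  obtain ⟨i, hi, hgi⟩ := hsol ⟨n, w⟩
    ⟨h0, fun i hi => hw i (Nat.cast_le.1 (show ((i + 1 : ℕ) : ℕ∞) ≤ n from hi))⟩
    (by
      intro m hm
      obtain rfl : n = m := Nat.cast_injective (show (n : ℕ∞) = m from hm)
      refine .inr ?_
      rcases ha : π.act (w n) with _ | a
      · exact .inl rfl
      · refine .inr ⟨a, rfl, fun ⟨t, ht⟩ => hdead ⟨t, a, ?_, ?_⟩⟩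
        · rwa [← hn]
        · rwa [← hn])
    (fun t ht => absurd ht (Trajectory.not_recurrent_of_len_eq rfl t))
  have hi' : i ≤ n := Nat.cast_le.1 (show (i : ℕ∞) ≤ n from hi)
  rcases hi'.lt_or_eq with hi' | rfl
  · exact FOND.not_isGoal_of_edge (hw i hi') hgi
  · exact hg (hn ▸ hgi)

/-- If `π` solves the FOND⁺ problem, then every infinite walk along transitions of `π` from a
reachable state violates the fairness of some recurrent state: some transition out of this state,
whose action has a fair occurrence, is used only finitely often. -/
theorem Solves.exists_unfair (hsol : Pc.Solves π) {f : ℕ → Set α}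
    (h0 : Pc.problem.Reachable π (f 0)) (hf : ∀ i, Pc.problem.Edge π (f i) (f (i + 1))) :
    ∃ s t, (∃ᶠ i in atTop, f i = s) ∧ Pc.problem.Edge π s t ∧
      (¬ ∃ᶠ i in atTop, f i = s ∧ f (i + 1) = t) ∧
      ∃ c ∈ Pc.C, (∃ a ∈ c.A, π.act s = some a) ∧
        ∀ b ∈ c.B, ¬ ∃ᶠ i in atTop, π.act (f i) = some b := by
  obtain ⟨g, N, hg0, hg, hgf⟩ := exists_walk_of_reflTransGen h0 hf
  have hshift : ∀ p : ℕ → Prop, (∃ᶠ i in atTop, p (i + N)) ↔ ∃ᶠ i in atTop, p i := by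
    intro p
    conv_rhs => rw [← map_add_atTop_eq_nat N, frequently_map]
  by_contra hcon
  obtain ⟨i, -, hgi⟩ := hsol ⟨⊤, g⟩ ⟨hg0, fun i _ => hg i⟩ (by intro n hn; simp at hn) (by
    intro s hs hfair t hst
    rw [Trajectory.recurrent_iff_frequently rfl, ← hshift] at hs
    by_contra hnot
    refine hcon ⟨s, t, by simpa [hgf] using hs, hst, ?_, ?_⟩
    · intro hfr
      refine hnot fun n => ?_
      have := (hshift fun i => g i = s ∧ g (i + 1) = t).1 (by
        simpa [hgf, show ∀ i, i + N + 1 = i + 1 + N by intro i; omega] using hfr)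
      obtain ⟨i, hi, h⟩ := frequently_atTop.1 this n
      exact ⟨i, hi, le_top, h⟩
    · obtain ⟨c, hc, ha, hb⟩ := hfair
      refine ⟨c, hc, ha, fun b hbB hfr => hb b hbB fun n => ?_⟩
      have := (hshift fun i => π.act (g i) = some b).1 (by simpa [hgf] using hfr)
      obtain ⟨i, hi, h⟩ := frequently_atTop.1 this n
      exact ⟨i, hi, le_top, h⟩)
  exact FOND.not_isGoal_of_edge (hg i) hgi

theorem Solves.strongCyclic [Finite α] (hsol : Pc.Solves π) : Pc.problem.StrongCyclic π := by
  intro s hs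
  by_contra! hno
  obtain ⟨f, hf0, hf, hfair⟩ := exists_fair_walk (R := Pc.problem.Edge π) (s₀ := s)
    fun t ht => hsol.exists_edge (hs.trans ht) fun hg => hno t hg ht
  obtain ⟨u, v, hu, huv, hnot, -⟩ := hsol.exists_unfair (hf0 ▸ hs) hf
  exact hnot (hfair u v huv hu)

end FONDPlus

/-! ### Terminating states -/

namespace FOND

variable {At V Act : Type*} {P : FOND (At ⊕ V) Act} {π : Policy P}

theorem TerminationRule.mono {X Y : Set (Set (At ⊕ V))} (hXY : X ⊆ Y) {s : Set (At ⊕ V)}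
    (h : P.TerminationRule π X s) : P.TerminationRule π Y s := by
  rcases h with h | h | ⟨a, x, ha, hx, h⟩
  · exact .inl h
  · refine .inr (.inl fun n w hw => ?_)
    obtain ⟨i, hi, hX⟩ := h n w hw
    exact ⟨i, hi, hXY hX⟩
  · refine .inr (.inr ⟨a, x, ha, hx, fun n w hw hinc => ?_⟩)
    obtain ⟨i, hi, hX⟩ := h n w hw hinc
    exact ⟨i, hi, hXY hX⟩

theorem TerminatingState.of_rule {s : Set (At ⊕ V)}
    (h : P.TerminationRule π {t | P.TerminatingState π t} s) : P.TerminatingState π s := by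
  intro X hX
  refine hX s (h.mono fun t ht => ?_)
  exact (show P.TerminatingState π t from ht) X hX

/-- The second rule fails for a state that is not terminating. -/
theorem exists_cycle_of_not_terminatingState {s : Set (At ⊕ V)} (h : ¬ P.TerminatingState π s) :
    ∃ n w, P.IsCycleOn π s n w ∧ ∀ i ≤ n, ¬ P.TerminatingState π (w i) := by
  by_contra! hcon
  exact h (.of_rule (.inr (.inl hcon)))

/-- The third rule fails for a state that is not terminating. -/
theorem exists_incrementing_cycle_of_not_terminatingState {s : Set (At ⊕ V)} {a : Act} {x : V}
    (h : ¬ P.TerminatingState π s) (ha : π.act s = some a) (hx : P.Decrements a x) :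
    ∃ n w, P.IsCycleOn π s n w ∧ (∃ i ≤ n, ∃ b, π.act (w i) = some b ∧ P.Increments b x) ∧
      ∀ i ≤ n, ¬ P.TerminatingState π (w i) := by
  by_contra! hcon
  refine h (.of_rule (.inr (.inr ⟨a, x, ha, hx, fun n w hw hinc => ?_⟩)))
  obtain ⟨i, hi, b, hb⟩ := hinc
  exact hcon n w hw ⟨i, hi, b, hb⟩

end FOND

namespace QNP

variable {At V Act : Type*} {Q : QNP At V Act} {π : Policy Q.directTranslation}

theorem terminates_of_solves [Finite At] [Finite V] (hsol : Q.toFONDPlus.Solves π) :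
    Q.directTranslation.Terminates π := by
  intro s hs
  by_contra hnt
  let T := Q.directTranslation.TerminatingState π
  let R : Set (At ⊕ V) → Set (At ⊕ V) → Prop := fun t u =>
    Q.directTranslation.Edge π t u ∧ ¬ T t ∧ ¬ T u
  have hsucc : ∀ t, ReflTransGen R s t → ∃ u, R t u := by
    intro t ht
    have htT : ¬ T t := by
      rcases ht.cases_tail with rfl | ⟨_, -, h⟩
      exacts [hnt, h.2.2]
    obtain ⟨n, w, ⟨hn, hw0, -, hw⟩, hwT⟩ := FOND.exists_cycle_of_not_terminatingState htT
    exact ⟨w 1, hw0 ▸ hw 0 hn, htT, hwT 1 hn⟩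
  obtain ⟨f, hf0, hf, hfair⟩ := exists_fair_walk hsucc
  have hclosed : ∀ t u, ReflTransGen R t u →
      (∃ᶠ i in atTop, f i = t) → ∃ᶠ i in atTop, f i = u := by
    intro t u htu ht
    induction htu with
    | refl => exact ht
    | tail _ huv ih =>
      rw [← map_add_atTop_eq_nat 1, frequently_map]
      exact (hfair _ _ huv ih).mono fun i hi => hi.2
  obtain ⟨t, u, ht, -, -, c, ⟨x, rfl⟩, ⟨a, hax, ha⟩, hB⟩ :=
    hsol.exists_unfair (f := f) (hf0 ▸ hs) fun i => (hf i).1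
  obtain ⟨j, hj⟩ := ht.exists
  have htT : ¬ T t := hj ▸ (hf j).2.1
  obtain ⟨n, w, ⟨-, hw0, -, hw⟩, ⟨i, hi, b, hb, hbx⟩, hwT⟩ :=
    FOND.exists_incrementing_cycle_of_not_terminatingState htT ha hax
  have hreach : ReflTransGen R t (w i) := hw0 ▸ reflTransGen_of_walk (Nat.zero_le i)
    fun k _ hk => ⟨hw k (by omega), hwT k (by omega), hwT (k + 1) (by omega)⟩
  exact hB b hbx ((hclosed _ _ hreach ht).mono fun k hk => hk ▸ hb)

/-! ### Qualitative shadows of numerical states -/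

theorem holds_translate_qualState (s : NumState At V) (l : QLiteral At V) :
    l.translate.Holds (qualState s) ↔ l.Holds s := by
  rcases l with (p | p) | x | x <;>
    simp [QLiteral.translate, Literal.Holds, QLiteral.Holds, qualState, pos_iff_ne_zero]

theorem isGoal_qualState (s : NumState At V) :
    Q.directTranslation.IsGoal (qualState s) ↔ Q.IsGoal s := by
  simp [FOND.IsGoal, QNP.IsGoal, directTranslation, holds_translate_qualState]

/-- The transitions of the direct translation, without reference to choices of outcomes: a
decremented variable may be zero or positive afterwards. -/
theorem mem_F_iff {a : Act} {s s' : Set (At ⊕ V)} :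
    s' ∈ Q.directTranslation.F a s ↔
      (∀ l ∈ (Q.action a).pre, l.translate.Holds s) ∧
      IsResult (Sum.inl ⁻¹' s) (Q.action a).eff (Sum.inl ⁻¹' s') ∧
      (∀ x ∈ (Q.action a).inc, Sum.inr x ∉ s') ∧
      ∀ x, x ∉ (Q.action a).inc → x ∉ (Q.action a).dec → (Sum.inr x ∈ s' ↔ Sum.inr x ∈ s) := by
  have hpre : (∀ l ∈ (Q.directTranslation.action a).pre, l.Holds s) ↔
      ∀ l ∈ (Q.action a).pre, l.translate.Holds s := by
    simp [directTranslation, QAction.translate]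
  have hbool : ∀ (l : Literal At) (t : Set (At ⊕ V)),
      (QLiteral.bool l : QLiteral At V).translate.Holds t ↔ l.Holds (Sum.inl ⁻¹' t) := by
    rintro (p | p) t <;> rfl
  simp only [FOND.F, Set.mem_ofPred_eq, hpre]
  refine and_congr_right fun _ => ⟨?_, ?_⟩
  · rintro ⟨E, ⟨c, hc, rfl⟩, hE, hframe⟩
    refine ⟨⟨fun l hl => (hbool l s').1 (hE _ (.inl (.inl ⟨l, hl, rfl⟩))), fun p hp hn => ?_⟩,
      fun x hx => hE _ (.inl (.inr ⟨x, hx, rfl⟩)), fun x hi hd => ?_⟩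
    all_goals
      refine hframe _ ?_ ?_
      all_goals
        rintro ((⟨l, hl, he⟩ | ⟨y, hy, he⟩) | h)
        · rcases l with q | q <;> simp_all [QLiteral.translate]
        · simp_all
        · simp only [Set.mem_iUnion] at h
          obtain ⟨o, ho, hm⟩ := h
          have hco := hc o ho
          obtain ⟨y, hy, rfl⟩ := ho
          rcases hco with hco | hco <;> (rw [hco] at hm; simp_all)
  · rintro ⟨⟨hE, hframe⟩, hinc, hrest⟩
    -- The alternatives chosen are those that hold in `s'`.
    refine ⟨_, ⟨fun o => {l | {l} ∈ o ∧ l.Holds s'}, ?_, rfl⟩, ?_, ?_⟩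
    · rintro o ⟨x, -, rfl⟩
      by_cases hx : Sum.inr x ∈ s'
      · refine .inl ?_
        ext l
        simp only [Set.mem_insert_iff, Set.mem_singleton_iff, Set.singleton_eq_singleton_iff,
          Set.mem_ofPred_eq]
        constructor
        · rintro ⟨rfl | rfl, hl⟩
          · rfl
          · exact absurd hx hl
        · rintro rfl
          exact ⟨.inl rfl, hx⟩
      · refine .inr ?_
        ext l
        simp only [Set.mem_insert_iff, Set.mem_singleton_iff, Set.singleton_eq_singleton_iff,
          Set.mem_ofPred_eq]
        constructor
        · rintro ⟨rfl | rfl, hl⟩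
          · exact absurd hl hx
          · rfl
        · rintro rfl
          exact ⟨.inr rfl, hx⟩
    · rintro l ((⟨l, hl, rfl⟩ | ⟨y, hy, rfl⟩) | h)
      · exact (hbool l s').2 (hE l hl)
      · exact hinc y hy
      · simp only [Set.mem_iUnion] at h
        obtain ⟨o, -, -, hl⟩ := h
        exact hl
    · rintro (p | x) hp hn
      · exact hframe p (fun h => hp (.inl (.inl ⟨_, h, rfl⟩))) fun h => hn (.inl (.inl ⟨_, h, rfl⟩))
      · refine hrest x (fun h => hn (.inl (.inr ⟨x, h, rfl⟩))) fun h => ?_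
        have hmem : ({{Literal.pos (Sum.inr x)}, {Literal.neg (Sum.inr x)}} :
            Set (Set (Literal (At ⊕ V)))) ∈ (Q.directTranslation.action a).oneof := ⟨x, h, rfl⟩
        by_cases hx : Sum.inr x ∈ s'
        · exact hp (.inr (Set.mem_biUnion hmem ⟨.inl rfl, hx⟩))
        · exact hn (.inr (Set.mem_biUnion hmem ⟨.inr rfl, hx⟩))

theorem applicable_qualState (a : Act) (s : NumState At V) :
    Q.directTranslation.Applicable a (qualState s) ↔ Q.Applicable a s := by
  constructor
  · rintro ⟨s', hs'⟩ l hl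
    exact (holds_translate_qualState s l).1 ((mem_F_iff.1 hs').1 l hl)
  · intro h
    refine ⟨{q | match q with
      | .inl p => .pos p ∈ (Q.action a).eff ∨ (p ∈ s.atoms ∧ .neg p ∉ (Q.action a).eff)
      | .inr x => x ∉ (Q.action a).inc ∧ s.val x = 0}, mem_F_iff.2 ⟨?_, ⟨?_, ?_⟩, ?_, ?_⟩⟩
    · exact fun l hl => (holds_translate_qualState s l).2 (h l hl)
    · rintro (p | p) hl
      · exact .inl hl
      · rintro (hp | hp)
        · exact (Q.action a).eff_consistent p ⟨hp, hl⟩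
        · exact hp.2 hl
    · intro p hp hn
      simp [hp, hn, qualState]
    · exact fun x hx hx' => hx'.1 hx
    · intro x hx _
      simp [hx, qualState]

theorem Step.qualState_mem_F {ε : NNReal} {a : Act} {s s' : NumState At V}
    (h : Q.Step ε a s s') : qualState s' ∈ Q.directTranslation.F a (qualState s) := by
  obtain ⟨hpre, hres, hinc, -, hrest⟩ := h
  refine mem_F_iff.2 ⟨fun l hl => (holds_translate_qualState s l).2 (hpre l hl), hres,
    fun x hx => ?_, fun x hi hd => ?_⟩
  · exact (pos_of_gt (hinc x hx)).ne'
  · simp [qualState, hrest x hi hd]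

/-- The numerical states that satisfy the initial situation are those over the initial state of the
direct translation. -/
theorem holds_init_iff (s : NumState At V) :
    (∀ l ∈ Q.init, l.Holds s) ↔ qualState s = Q.directTranslation.init := by
  have hl : ∀ p : At, Sum.inl p ∈ Q.directTranslation.init ↔ .bool (.pos p) ∈ Q.init := by
    intro p
    constructor
    · rintro ⟨l, hl, he⟩
      rcases l with (q | q) | q | q <;> simp_all [QLiteral.translate]
    · exact fun h => ⟨_, h, rfl⟩
  have hr : ∀ x : V, Sum.inr x ∈ Q.directTranslation.init ↔ .eqZero x ∈ Q.init := by
    intro x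
    constructor
    · rintro ⟨l, hl, he⟩
      rcases l with (q | q) | q | q <;> simp_all [QLiteral.translate]
    · exact fun h => ⟨_, h, rfl⟩
  constructor
  · intro h
    ext (p | x)
    · rw [hl]
      refine ⟨fun hp => ?_, fun hp => h _ hp⟩
      rcases Q.init_bool p with ⟨h1, -⟩ | ⟨h1, -⟩
      · exact h1
      · exact absurd hp (h _ h1)
    · rw [hr]
      refine ⟨fun hp => ?_, fun hp => h _ hp⟩
      rcases Q.init_num x with ⟨h1, -⟩ | ⟨h1, -⟩
      · exact h1
      · exact absurd hp (h _ h1 : 0 < s.val x).ne'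
  · rintro h l hlQ
    rw [← holds_translate_qualState, h]
    rcases l with (p | p) | x | x
    · exact (hl p).2 hlQ
    · intro hp
      rcases Q.init_bool p with ⟨-, h1⟩ | ⟨-, h1⟩
      · exact h1 hlQ
      · exact h1 ((hl p).1 hp)
    · exact (hr x).2 hlQ
    · intro hp
      rcases Q.init_num x with ⟨-, h1⟩ | ⟨-, h1⟩
      · exact h1 hlQ
      · exact h1 ((hr x).1 hp)

/-! ### Terminating policies solve the QNP -/

/-- A variable that is decremented infinitely often in an infinite `ε`-bounded trajectory is
incremented infinitely often. -/
theorem frequently_inc_of_frequently_dec {ε : NNReal} (hε : 0 < ε) {σ : ℕ → NumState At V}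
    {a : ℕ → Act} (hσ : ∀ i, Q.Step ε (a i) (σ i) (σ (i + 1))) {x : V}
    (hdec : ∃ᶠ i in atTop, x ∈ (Q.action (a i)).dec) :
    ∃ᶠ i in atTop, x ∈ (Q.action (a i)).inc := by
  by_contra hinc
  obtain ⟨N, hN⟩ := eventually_atTop.1 (not_frequently.1 hinc)
  have hanti : ∀ i j, N ≤ i → i ≤ j → (σ j).val x ≤ (σ i).val x := by
    intro i j hi hij
    induction j, hij using Nat.le_induction with
    | base => exact le_rfl
    | succ j hij ih =>
      refine le_trans ?_ ih
      by_cases hd : x ∈ (Q.action (a j)).dec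
      · exact ((hσ j).2.2.2.1 x hd).1.le
      · exact ((hσ j).2.2.2.2 x (hN j (hi.trans hij)) hd).le
  -- A decrement to zero is impossible, because a further decrement follows.
  have hdrop : ∀ i, N ≤ i → x ∈ (Q.action (a i)).dec → (σ (i + 1)).val x + ε ≤ (σ i).val x := by
    intro i hi hd
    refine ((hσ i).2.2.2.1 x hd).2.resolve_left fun h0 => ?_
    obtain ⟨j, hj, hdj⟩ := frequently_atTop.1 hdec (i + 1)
    have hpos : 0 < (σ j).val x := (hσ j).1 _ ((Q.action (a j)).dec_pre x hdj)
    exact absurd (hanti (i + 1) j (by omega) hj) (by rw [h0]; exact not_le.2 hpos)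
  have hsum : ∀ k : ℕ, ∃ i, N ≤ i ∧ (σ i).val x + k * ε ≤ (σ N).val x := by
    intro k
    induction k with
    | zero => exact ⟨N, le_rfl, by simp⟩
    | succ k ih =>
      obtain ⟨i, hi, hk⟩ := ih
      obtain ⟨j, hj, hdj⟩ := frequently_atTop.1 hdec i
      refine ⟨j + 1, by omega, ?_⟩
      calc (σ (j + 1)).val x + (k + 1 : ℕ) * ε = (σ (j + 1)).val x + ε + k * ε := by
            push_cast; ring
        _ ≤ (σ i).val x + k * ε := by
            gcongr
            exact (hdrop j (hi.trans hj) hdj).trans (hanti i j hi hj)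
        _ ≤ _ := hk
  obtain ⟨k, hk⟩ := exists_nat_gt ((σ N).val x / ε)
  obtain ⟨i, -, hi⟩ := hsum k
  rw [div_lt_iff₀ hε] at hk
  exact absurd (le_trans le_add_self hi) (not_le.2 hk)

/-- A state that recurs in an infinite `ε`-bounded trajectory is not terminating. -/
theorem not_terminatingState_of_recurrent [Finite At] [Finite V] {ε : NNReal} (hε : 0 < ε)
    {σ : ℕ → NumState At V} {a : ℕ → Act} (ha : ∀ i, π.act (qualState (σ i)) = some (a i))
    (hσ : ∀ i, Q.Step ε (a i) (σ i) (σ (i + 1))) {s : Set (At ⊕ V)}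
    (hs : ∃ᶠ i in atTop, qualState (σ i) = s) : ¬ Q.directTranslation.TerminatingState π s := by
  have hedge : ∀ i, Q.directTranslation.Edge π (qualState (σ i)) (qualState (σ (i + 1))) :=
    fun i => ⟨a i, ha i, (hσ i).qualState_mem_F⟩
  obtain ⟨N, hN⟩ := eventually_atTop.1 (eventually_frequently_eq fun i => qualState (σ i))
  intro hT
  refine hT {t | ¬ ∃ᶠ i in atTop, qualState (σ i) = t} (fun t hrule ht => ?_) hs
  have hcycle : ∀ m n, qualState (σ m) = t → qualState (σ n) = t → m < n →
      Q.directTranslation.IsCycleOn π t (n - m) fun i => qualState (σ (m + i)) := by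
    rintro m n rfl hn hmn
    exact FOND.isCycleOn_segment (f := fun i => qualState (σ i)) hedge hmn hn
  obtain ⟨m, hm, hmt⟩ := frequently_atTop.1 ht N
  -- All states of a cycle on `t` that starts at the time `m` recur.
  rcases hrule with h | h | ⟨b, x, hb, hdec, h⟩
  · obtain ⟨n, hn, hnt⟩ := frequently_atTop.1 ht (m + 1)
    exact h _ _ (hcycle m n hmt hnt hn)
  · obtain ⟨n, hn, hnt⟩ := frequently_atTop.1 ht (m + 1)
    obtain ⟨i, -, hi⟩ := h _ _ (hcycle m n hmt hnt hn)
    exact hi (hN (m + i) (by omega))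
  · have hfd : ∃ᶠ i in atTop, x ∈ (Q.action (a i)).dec := ht.mono fun i hi => by
      have : a i = b := by simpa [hi, hb] using (ha i).symm
      exact this ▸ (Q.decrements_iff b x).1 hdec
    obtain ⟨k, hk, hki⟩ :=
      frequently_atTop.1 (frequently_inc_of_frequently_dec hε hσ hfd) m
    obtain ⟨n, hn, hnt⟩ := frequently_atTop.1 ht (k + 1)
    obtain ⟨i, -, hi⟩ := h _ _ (hcycle m n hmt hnt (by omega)) ⟨k - m, by omega, a k, by
      simpa [show m + (k - m) = k by omega] using ha k, (Q.increments_iff _ _).2 hki⟩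
    exact hi (hN (m + i) (by omega))

theorem solves_of_strongCyclic_of_terminates [Finite At] [Finite V]
    (hsc : Q.directTranslation.StrongCyclic π) (hterm : Q.directTranslation.Terminates π) :
    Q.Solves π := by
  rintro ε hε ⟨len, σ⟩ ⟨hinit, hstep⟩ hmax
  by_contra hgoal
  have hreach : ∀ i : ℕ, (i : ℕ∞) ≤ len → Q.directTranslation.Reachable π (qualState (σ i)) := by
    intro i hi
    rw [FOND.Reachable, ← (holds_init_iff _).1 hinit]
    refine reflTransGen_of_walk (w := fun i => qualState (σ i)) (Nat.zero_le i) fun k _ hk => ?_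
    obtain ⟨a, ha, hs⟩ := hstep k (le_trans (by exact_mod_cast hk) hi)
    exact ⟨a, ha, hs.qualState_mem_F⟩
  induction len using ENat.recTopCoe with
  | top =>
    choose a ha hs using fun i => hstep i le_top
    obtain ⟨i, hi⟩ := (eventually_frequently_eq fun i => qualState (σ i)).exists
    exact not_terminatingState_of_recurrent hε ha hs hi (hterm _ (hreach i le_top))
  | coe n =>
    have hng : ¬ Q.IsGoal (σ n) := fun h => hgoal ⟨n, le_rfl, h⟩
    obtain ⟨g, hg, hpath⟩ := hsc _ (hreach n le_rfl)
    rcases hpath.cases_head with rfl | ⟨t, ⟨a, ha, ht⟩, -⟩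
    · exact hng ((isGoal_qualState _).1 hg)
    · rcases hmax n rfl with h | h | ⟨b, hb, hnot⟩
      · exact hng h
      · simp [h] at ha
      · obtain rfl : a = b := by simpa [ha] using hb
        exact hnot ((applicable_qualState a _).1 ⟨t, ht⟩)

/-! ### Lifting qualitative trajectories -/

/-- A trajectory of the direct translation, in which every variable is incremented infinitely often
or decremented only finitely often, is the sequence of qualitative states of a `1`-bounded
trajectory of the QNP. The values are natural numbers: a positive variable always exceeds the
number of its decrements before its next increment. -/
theorem exists_numTrajectory {τ : Trajectory (Set (At ⊕ V))}
    (hτ : Q.directTranslation.IsTrajectory π τ)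
    (h : ∀ x, (∃ᶠ i in atTop, ∃ a, π.act (τ.state i) = some a ∧ x ∈ (Q.action a).inc) ∨
      ∀ᶠ i : ℕ in atTop, ¬ (((i + 1 : ℕ) : ℕ∞) ≤ τ.len ∧
        ∃ a, π.act (τ.state i) = some a ∧ x ∈ (Q.action a).dec)) :
    ∃ σ : ℕ → NumState At V, Q.IsTrajectory π 1 ⟨τ.len, σ⟩ ∧
      ∀ i : ℕ, (i : ℕ∞) ≤ τ.len → qualState (σ i) = τ.state i := by
  classical
  obtain ⟨hτ0, hτ⟩ := hτ
  have hdisj : ∀ a x, x ∈ (Q.action a).inc → x ∉ (Q.action a).dec := fun a x =>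
    fun h1 h2 => Set.disjoint_left.1 (Q.action a).inc_dec_disjoint h1 h2
  have hD := fun x => exists_rank (fun i => by
    rintro ⟨a, ha, hi⟩ ⟨-, b, hb, hd⟩
    obtain rfl : a = b := by simpa [ha] using hb
    exact hdisj a x hi hd) (h x)
  choose D hD using hD
  let v : V → ℕ → ℕ := fun x i => Nat.rec (if Sum.inr x ∈ τ.state 0 then 0 else D x 0 + 1)
    (fun i q => if Sum.inr x ∈ τ.state (i + 1) then 0
      else if ∃ a, π.act (τ.state i) = some a ∧ x ∈ (Q.action a).inc then q + D x (i + 1) + 1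
      else if ∃ a, π.act (τ.state i) = some a ∧ x ∈ (Q.action a).dec then q - 1
      else q) i
  have hv0 : ∀ x i, Sum.inr x ∈ τ.state i → v x i = 0 := by
    rintro x (_ | i) hx <;> simp [v, hx]
  have hvinc : ∀ x i a, π.act (τ.state i) = some a → x ∈ (Q.action a).inc →
      Sum.inr x ∉ τ.state (i + 1) → v x (i + 1) = v x i + D x (i + 1) + 1 := by
    intro x i a ha hx hn
    simp [v, ha, hx, hn]
  have hvdec : ∀ x i a, π.act (τ.state i) = some a → x ∈ (Q.action a).dec →
      Sum.inr x ∉ τ.state (i + 1) → v x (i + 1) = v x i - 1 := by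
    intro x i a ha hx hn
    have hx' : x ∉ (Q.action a).inc := fun h => hdisj a x h hx
    simp [v, ha, hx, hx', hn]
  have hvnop : ∀ x i a, π.act (τ.state i) = some a → x ∉ (Q.action a).inc →
      x ∉ (Q.action a).dec → Sum.inr x ∉ τ.state (i + 1) → v x (i + 1) = v x i := by
    intro x i a ha hx hx' hn
    simp [v, ha, hx, hx', hn]
  have hvinit : ∀ x, Sum.inr x ∉ τ.state 0 → D x 0 < v x 0 := by
    intro x hx
    simp [v, hx]
  clear_value v
  have hdpos : ∀ x i a t, t ∈ Q.directTranslation.F a (τ.state i) → x ∈ (Q.action a).dec →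
      Sum.inr x ∉ τ.state i := by
    intro x i a t ht hx
    exact (mem_F_iff.1 ht).1 _ ((Q.action a).dec_pre x hx)
  have hinv : ∀ x (i : ℕ), (i : ℕ∞) ≤ τ.len → Sum.inr x ∉ τ.state i → D x i < v x i := by
    intro x i
    induction i with
    | zero => exact fun _ => hvinit x
    | succ i ih =>
      intro hi hx
      obtain ⟨a, ha, hF⟩ := hτ i hi
      have hi' : (i : ℕ∞) ≤ τ.len := le_trans (by exact_mod_cast Nat.le_succ i) hi
      obtain ⟨hD1, hD2⟩ := hD x i
      by_cases hinc : x ∈ (Q.action a).inc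
      · rw [hvinc x i a ha hinc hx]
        omega
      by_cases hdec : x ∈ (Q.action a).dec
      · rw [hvdec x i a ha hdec hx]
        have h1 := ih hi' (hdpos x i a _ hF hdec)
        have h2 := hD1 ⟨hi, a, ha, hdec⟩
        omega
      · rw [hvnop x i a ha hinc hdec hx]
        have h1 := ih hi' (mt ((mem_F_iff.1 hF).2.2.2 x hinc hdec).2 hx)
        have h2 := hD2 (by
          rintro ⟨b, hb, hbx⟩
          obtain rfl : a = b := by simpa [ha] using hb
          exact hinc hbx)
        omega
  let σ : ℕ → NumState At V := fun i => ⟨Sum.inl ⁻¹' τ.state i, fun x => (v x i : NNReal)⟩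
  have hqual : ∀ i : ℕ, (i : ℕ∞) ≤ τ.len → qualState (σ i) = τ.state i := by
    intro i hi
    ext (p | x)
    · rfl
    · show (v x i : NNReal) = 0 ↔ _
      rw [Nat.cast_eq_zero]
      refine ⟨fun h0 => ?_, hv0 x i⟩
      by_contra hx
      have := hinv x i hi hx
      omega
  refine ⟨σ, ⟨(holds_init_iff _).2 ((hqual 0 (by simp)).trans hτ0), fun i hi => ?_⟩, hqual⟩
  have hi' : (i : ℕ∞) ≤ τ.len := le_trans (by exact_mod_cast Nat.le_succ i) hi
  obtain ⟨a, ha, hF⟩ := hτ i hi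
  obtain ⟨hpre, hres, hinc, hnop⟩ := mem_F_iff.1 hF
  refine ⟨a, by rw [← ha]; exact congrArg π.act (hqual i hi'), ?_, hres, ?_, ?_, ?_⟩
  · intro l hl
    rw [← holds_translate_qualState]
    exact (hqual i hi').symm ▸ hpre l hl
  · intro x hx
    show (v x i : NNReal) < (v x (i + 1) : NNReal)
    rw [hvinc x i a ha hx (hinc x hx)]
    exact Nat.cast_lt.2 (by omega)
  · intro x hx
    show (v x (i + 1) : NNReal) < (v x i : NNReal) ∧
      ((v x (i + 1) : NNReal) = 0 ∨ (v x (i + 1) : NNReal) + 1 ≤ (v x i : NNReal))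
    have hpos := hinv x i hi' (hdpos x i a _ hF hx)
    have hlt : v x (i + 1) < v x i := by
      by_cases hz : Sum.inr x ∈ τ.state (i + 1)
      · rw [hv0 x _ hz]
        omega
      · rw [hvdec x i a ha hx hz]
        omega
    exact ⟨by exact_mod_cast hlt, .inr (by exact_mod_cast hlt)⟩
  · intro x hi hd
    show (v x (i + 1) : NNReal) = (v x i : NNReal)
    by_cases hz : Sum.inr x ∈ τ.state (i + 1)
    · rw [hv0 x _ hz, hv0 x _ ((hnop x hi hd).1 hz)]
    · rw [hvnop x i a ha hi hd hz]

/-- In an infinite fair trajectory, a variable that is decremented infinitely often is incremented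
infinitely often: otherwise fairness produces a late transition that makes it zero, and it stays zero
although later decrements require it to be positive. -/
theorem frequently_inc_of_fair [Finite At] [Finite V] {f : ℕ → Set (At ⊕ V)}
    (hf : ∀ i, Q.directTranslation.Edge π (f i) (f (i + 1)))
    (hfair : Q.toFONDPlus.Fair π ⟨⊤, f⟩) {x : V}
    (hdec : ∃ᶠ i in atTop, ∃ a, π.act (f i) = some a ∧ x ∈ (Q.action a).dec) :
    ∃ᶠ i in atTop, ∃ a, π.act (f i) = some a ∧ x ∈ (Q.action a).inc := by
  by_contra hinc
  obtain ⟨i₀, ⟨a, ha, hax⟩, hrec⟩ := (hdec.and_eventually (eventually_frequently_eq f)).exists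
  -- The successor of the recurrent state `f i₀` in which `x` becomes zero.
  have hedge : Q.directTranslation.Edge π (f i₀) (insert (Sum.inr x) (f (i₀ + 1))) := by
    obtain ⟨b, hb, hF⟩ := hf i₀
    obtain rfl : a = b := by simpa [ha] using hb
    obtain ⟨h1, h2, h3, h4⟩ := mem_F_iff.1 hF
    refine ⟨a, ha, mem_F_iff.2 ⟨h1, ?_, fun y hy => ?_, fun y hy hy' => ?_⟩⟩
    · convert h2 using 1
      ext p
      simp
    · have hne : y ≠ x := by
        rintro rfl
        exact Set.disjoint_left.1 (Q.action a).inc_dec_disjoint hy hax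
      simpa [hne] using h3 y hy
    · have hne : y ≠ x := by
        rintro rfl
        exact hy' hax
      simpa [hne] using h4 y hy hy'
  have hfol := hfair (f i₀) ((Trajectory.recurrent_iff_frequently rfl).2 hrec)
    ⟨Q.assumption x, ⟨x, rfl⟩, ⟨a, (Q.decrements_iff a x).2 hax, ha⟩, fun b hb hocc =>
      hinc (frequently_atTop.2 fun n => by
        obtain ⟨i, hi, -, hbi⟩ := hocc n
        exact ⟨i, hi, b, hbi, (Q.increments_iff b x).1 hb⟩)⟩ _ hedge
  obtain ⟨N, hN⟩ := eventually_atTop.1 (not_frequently.1 hinc)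
  obtain ⟨j, hj, -, -, hz⟩ := hfol N
  have hzero : ∀ k, j + 1 ≤ k → Sum.inr x ∈ f k := by
    intro k hk
    induction k, hk using Nat.le_induction with
    | base =>
      rw [show f (j + 1) = _ from hz]
      exact Set.mem_insert _ _
    | succ k hk ih =>
      obtain ⟨b, hb, hF⟩ := hf k
      obtain ⟨h1, -, -, h4⟩ := mem_F_iff.1 hF
      exact (h4 x (fun h => hN k (by omega) ⟨b, hb, h⟩)
        fun h => h1 _ ((Q.action b).dec_pre x h) ih).2 ih
  obtain ⟨k, hk, b, hb, hbx⟩ := frequently_atTop.1 hdec (j + 1)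
  obtain ⟨c, hc, hF⟩ := hf k
  obtain rfl : b = c := by simpa [hb] using hc
  exact (mem_F_iff.1 hF).1 _ ((Q.action b).dec_pre x hbx) (hzero k hk)

theorem toFONDPlus_solves_of_solves [Finite At] [Finite V] (hsol : Q.Solves π) :
    Q.toFONDPlus.Solves π := by
  intro τ hτ hmax hfair
  obtain ⟨σ, hσ, hq⟩ := exists_numTrajectory hτ (fun x => by
    rcases τ with ⟨len, f⟩
    induction len using ENat.recTopCoe with
    | top =>
      by_cases hdec : ∃ᶠ i in atTop, ∃ a, π.act (f i) = some a ∧ x ∈ (Q.action a).dec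
      · exact .inl (frequently_inc_of_fair (fun i => hτ.2 i le_top) hfair hdec)
      · exact .inr ((not_frequently.1 hdec).mono fun i hi h => hi h.2)
    | coe n =>
      refine .inr (eventually_atTop.2 ⟨n, fun i hi h => ?_⟩)
      have : i + 1 ≤ n := Nat.cast_le.1 (show ((i + 1 : ℕ) : ℕ∞) ≤ n from h.1)
      omega)
  obtain ⟨i, hi, hg⟩ := hsol 1 one_pos ⟨τ.len, σ⟩ hσ (by
    intro n hn
    have hqn := hq n hn.ge
    show Q.IsGoal (σ n) ∨ π.act (qualState (σ n)) = none ∨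
      ∃ a, π.act (qualState (σ n)) = some a ∧ ¬ Q.Applicable a (σ n)
    simp only [← applicable_qualState, ← isGoal_qualState, hqn]
    exact hmax n hn)
  exact ⟨i, hi, hq i hi ▸ (isGoal_qualState _).2 hg⟩

end QNP

end Planning

theorem mainTheorem2 {At V Act : Type*} [Finite At] [Finite V] (Q : Planning.QNP At V Act)
    (π : Planning.Policy Q.directTranslation) :
    (Q.Solves π ↔ Q.toFONDPlus.Solves π) ∧
    ((Q.directTranslation.StrongCyclic π ∧ Q.directTranslation.Terminates π) ↔
      Q.toFONDPlus.Solves π) := by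
  have h₁ : Q.toFONDPlus.Solves π →
      Q.directTranslation.StrongCyclic π ∧ Q.directTranslation.Terminates π :=
    fun h => ⟨h.strongCyclic, Planning.QNP.terminates_of_solves h⟩
  have h₂ : Q.directTranslation.StrongCyclic π ∧ Q.directTranslation.Terminates π → Q.Solves π :=
    fun h => Planning.QNP.solves_of_strongCyclic_of_terminates h.1 h.2
  have h₃ : Q.Solves π → Q.toFONDPlus.Solves π := Planning.QNP.toFONDPlus_solves_of_solves
  exact ⟨⟨h₃, h₂ ∘ h₁⟩, ⟨h₃ ∘ h₂, h₁⟩⟩
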